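/- Let $\mathscr{H}$ be a complex Hilbert space of arbitrary (possibly infinite) dimension. For a bounded operator $T$ on $\mathscr{H}$ put $\mathrm{tr}(T)=\sum_i\langle e_i,T e_i\rangle$, where $(e_i)_i$ is an orthonormal basis of $\mathscr{H}$, and put $|T|=\sqrt{T^\dagger T}$. A state (density operator) is a positive operator $\varrho$ with $\mathrm{tr}(\varrho)=1$. An effect is an operator $p$ with $0\le p\le \mathrm{id}$; it is sharp (a projection) if $p^2=p$. Write $\mathcal{E}f(\mathscr{H})$ for the set of effects. Let $\varrho_1,\varrho_2$ be states on $\mathscr{H}$. Then the traces $\mathrm{tr}(\varrho_1 p)$ and $\mathrm{tr}(\varrho_2 p)$, for every effect $p$, and $\mathrm{tr}\,|\varrho_1-\varrho_2|$ are given by absolutely convergent series, are real, and do not depend on the orthonormal basis, and the trace distance $\mathsf{trd}(\varrho_1,\varrho_2)=\tfrac12\,\mathrm{tr}\,|\varrho_1-\varrho_2|$ satisfies $$\mathsf{trd}(\varrho_1,\varrho_2)\;=\;\sup_{p\in\mathcal{E}f(\mathscr{H})}\bigl|\mathrm{tr}(\varrho_1p)-\mathrm{tr}(\varrho_2p)\bigr|\;=\;\max_{s\in\mathcal{E}f(\mathscr{H})\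 \text{sharp}}\bigl(\mathrm{tr}(\varrho_1s)-\mathrm{tr}(\varrho_2s)\bigr),$$ where the maximum is attained by a sharp effect. -/

import Mathlib

open scoped InnerProductSpace

namespace QuantumTrace

universe u

variable (H : Type u) [NormedAddCommGroup H] [InnerProductSpace ℂ H] [CompleteSpace H]

/-- The vectors of a fixed orthonormal (Hilbert) basis of `H`. -/
noncomputable def onbIndex : Set H := (exists_hilbertBasis ℂ H).choose

/-- A fixed orthonormal (Hilbert) basis of `H`. -/
noncomputable def onb : HilbertBasis (onbIndex H) ℂ H :=
  (exists_hilbertBasis ℂ H).choose_spec.choose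

variable {H}

/-- `HasTrace T t`: for every orthonormal basis `b` of `H`, the series `∑ ⟨b i, T (b i)⟩` converges
unconditionally (equivalently, absolutely) with sum `t`. So the trace of `T` is defined, does not
depend on the basis, and is equal to `t`. -/
def HasTrace (T : H →L[ℂ] H) (t : ℂ) : Prop :=
  ∀ (ι : Type u) (b : HilbertBasis ι ℂ H), HasSum (fun i => ⟪b i, T (b i)⟫_ℂ) t

/-- The trace `tr T = ∑ ⟨e i, T (e i)⟩`, computed in a fixed orthonormal basis. If the series does
not converge (for positive `T`: if the trace is `+∞`), the value is `0`. -/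
noncomputable def trace (T : H →L[ℂ] H) : ℂ :=
  ∑' i, ⟪onb H i, T (onb H i)⟫_ℂ

/-- States of `H`, also called density operators: positive operators of trace one.
(A positive operator of infinite trace is no state: its `trace` is `0`.) -/
def IsState (ρ : H →L[ℂ] H) : Prop := 0 ≤ ρ ∧ trace ρ = 1

/-- Effects of `H`: operators `p` with `0 ≤ p ≤ 1` in the Loewner order. -/
def IsEffect (p : H →L[ℂ] H) : Prop := 0 ≤ p ∧ p ≤ 1

/-- Sharp effects, i.e. projections: effects `s` with `s ^ 2 = s`. -/
def IsSharpEffect (s : H →L[ℂ] H) : Prop := IsEffect s ∧ s ^ 2 = s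

/-- The validity `ρ ⊨ p`, the (real) number `tr (ρ p)`. -/
noncomputable def validity (ρ p : H →L[ℂ] H) : ℝ := (trace (ρ * p)).re

/-- The trace distance `½ tr |ρ₁ - ρ₂|`, where `|T| = √(T† T)` is given by `CFC.abs`. -/
noncomputable def trd (ρ₁ ρ₂ : H →L[ℂ] H) : ℝ := (trace (CFC.abs (ρ₁ - ρ₂))).re / 2

end QuantumTrace

namespace QuantumTrace

open scoped ComplexOrder

variable {H : Type*} [NormedAddCommGroup H] [InnerProductSpace ℂ H] [CompleteSpace H]

/-! ### Parseval's identity and Hilbert-Schmidt operators -/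

/-! Let D = ρ₁ - ρ₂ = D⁺ - D⁻. Since tr D = 0, both parts have the same trace d, and tr |D| = 2d.
For an effect p, tr(D p) = tr(D⁺ p) - tr(D⁻ p) is a difference of two numbers in [0, d]
(`exists_hasTrace_mul_effect`), so |tr(D p)| ≤ d. A projection s with D⁺ s = D⁺ and D⁻ s = 0
(`exists_isStarProjection_mul_eq_left`) attains d. Convergence and basis independence come from
Hilbert-Schmidt operators: √ρ is one, and tr(ρ X) is the Hilbert-Schmidt inner product of √ρ and √ρ
X. -/

omit [CompleteSpace H] in
theorem tsum_ofReal_norm_inner_sq {ι : Type*} (b : HilbertBasis ι ℂ H) (x : H) :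
    ∑' i, ENNReal.ofReal (‖⟪b i, x⟫_ℂ‖ ^ 2) = ENNReal.ofReal (‖x‖ ^ 2) := by
  have h : HasSum (fun i => ‖⟪b i, x⟫_ℂ‖ ^ 2) (‖x‖ ^ 2) := by
    rw [← Complex.hasSum_ofReal]
    convert! b.hasSum_inner_mul_inner x x using 1
    · funext i
      rw [← inner_conj_symm x (b i), mul_comm, Complex.mul_conj']
      push_cast
      rfl
    · rw [inner_self_eq_norm_sq_to_K]
      push_cast
      rfl
  rw [← h.tsum_eq, ENNReal.ofReal_tsum_of_nonneg (fun _ => sq_nonneg _) h.summable]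

/-- By Parseval both sides are the double sum of |⟨c j, A (b i)⟩|²; in `ENNReal` the order can be
swapped without summability. -/
theorem tsum_norm_sq_eq_tsum_norm_adjoint_sq {ι κ : Type*} (b : HilbertBasis ι ℂ H)
    (c : HilbertBasis κ ℂ H) (A : H →L[ℂ] H) :
    ∑' i, ENNReal.ofReal (‖A (b i)‖ ^ 2) = ∑' j, ENNReal.ofReal (‖star A (c j)‖ ^ 2) := by
  simp_rw [← tsum_ofReal_norm_inner_sq c (A _),
    ← tsum_ofReal_norm_inner_sq b (star A _)]
  rw [ENNReal.tsum_comm]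
  refine tsum_congr fun j => tsum_congr fun i => ?_
  rw [ContinuousLinearMap.star_eq_adjoint, ContinuousLinearMap.adjoint_inner_right,
    norm_inner_symm]

theorem hasSum_norm_adjoint_sq {ι κ : Type*} (b : HilbertBasis ι ℂ H) (c : HilbertBasis κ ℂ H)
    {A : H →L[ℂ] H} {t : ℝ} (h : HasSum (fun i => ‖A (b i)‖ ^ 2) t) :
    HasSum (fun j => ‖star A (c j)‖ ^ 2) t := by
  have ht : 0 ≤ t := h.nonneg fun _ => sq_nonneg _
  have h' : ∑' j, ENNReal.ofReal (‖star A (c j)‖ ^ 2) = ENNReal.ofReal t := by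
    rw [← tsum_norm_sq_eq_tsum_norm_adjoint_sq b c, ← h.tsum_eq,
      ENNReal.ofReal_tsum_of_nonneg (fun _ => sq_nonneg _) h.summable]
  have hs := ENNReal.hasSum_toReal (h' ▸ ENNReal.ofReal_ne_top)
  rw [← ENNReal.tsum_toReal_eq (fun _ => ENNReal.ofReal_ne_top), h', ENNReal.toReal_ofReal ht] at hs
  simpa [ENNReal.toReal_ofReal] using hs

/-- Hilbert-Schmidt operators, in terms of the fixed orthonormal basis. -/
def IsHilbertSchmidt (A : H →L[ℂ] H) : Prop := Summable fun i => ‖A (onb H i)‖ ^ 2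

/-- The square of the Hilbert-Schmidt norm. -/
noncomputable def hsNormSq (A : H →L[ℂ] H) : ℝ := ∑' i, ‖A (onb H i)‖ ^ 2

namespace IsHilbertSchmidt

variable {A B : H →L[ℂ] H}

theorem hasSum_adjoint (hA : IsHilbertSchmidt A) {ι : Type*} (b : HilbertBasis ι ℂ H) :
    HasSum (fun i => ‖star A (b i)‖ ^ 2) (hsNormSq A) :=
  hasSum_norm_adjoint_sq (onb H) b hA.hasSum

theorem adjoint (hA : IsHilbertSchmidt A) : IsHilbertSchmidt (star A) :=
  (hA.hasSum_adjoint (onb H)).summable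

theorem hsNormSq_adjoint (hA : IsHilbertSchmidt A) : hsNormSq (star A) = hsNormSq A :=
  (hA.hasSum_adjoint (onb H)).tsum_eq

/-- Passing to the adjoint twice replaces the fixed basis by an arbitrary one. -/
theorem hasSum (hA : IsHilbertSchmidt A) {ι : Type*} (b : HilbertBasis ι ℂ H) :
    HasSum (fun i => ‖A (b i)‖ ^ 2) (hsNormSq A) := by
  have h := hA.adjoint.hasSum_adjoint b
  rwa [star_star, hA.hsNormSq_adjoint] at h

theorem mul_left (hA : IsHilbertSchmidt A) (X : H →L[ℂ] H) : IsHilbertSchmidt (X * A) := by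
  refine Summable.of_nonneg_of_le (fun _ => sq_nonneg _) (fun i => ?_)
    (Summable.mul_left (‖X‖ ^ 2) hA)
  rw [← mul_pow]
  exact pow_le_pow_left₀ (norm_nonneg _) (X.le_opNorm _) 2

theorem mul_right (hA : IsHilbertSchmidt A) (X : H →L[ℂ] H) : IsHilbertSchmidt (A * X) := by
  simpa using (hA.adjoint.mul_left (star X)).adjoint

theorem smul (hA : IsHilbertSchmidt A) (c : ℂ) : IsHilbertSchmidt (c • A) := by
  simpa using hA.mul_left (c • 1)

theorem add (hA : IsHilbertSchmidt A) (hB : IsHilbertSchmidt B) : IsHilbertSchmidt (A + B) := by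
  refine Summable.of_nonneg_of_le (fun _ => sq_nonneg _) (fun i => ?_)
    ((Summable.add hA hB).mul_left 2)
  calc ‖A (onb H i) + B (onb H i)‖ ^ 2 ≤ (‖A (onb H i)‖ + ‖B (onb H i)‖) ^ 2 :=
        pow_le_pow_left₀ (norm_nonneg _) (norm_add_le _ _) 2
    _ ≤ _ := add_sq_le

theorem sub (hA : IsHilbertSchmidt A) (hB : IsHilbertSchmidt B) : IsHilbertSchmidt (A - B) := by
  simpa [sub_eq_add_neg] using hA.add (hB.smul (-1))

end IsHilbertSchmidt

/-- The Hilbert-Schmidt inner product, given by polarization. -/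
noncomputable def hsInner (A B : H →L[ℂ] H) : ℂ :=
  ((hsNormSq (A + B) : ℂ) - hsNormSq (A - B) +
    ((hsNormSq (A - Complex.I • B) : ℂ) - hsNormSq (A + Complex.I • B)) * Complex.I) / 4

theorem IsHilbertSchmidt.hasSum_inner {A B : H →L[ℂ] H} (hA : IsHilbertSchmidt A)
    (hB : IsHilbertSchmidt B) {ι : Type*} (b : HilbertBasis ι ℂ H) :
    HasSum (fun i => ⟪A (b i), B (b i)⟫_ℂ) (hsInner A B) := by
  have h₁ := Complex.hasSum_ofReal.2 ((hA.add hB).hasSum b)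
  have h₂ := Complex.hasSum_ofReal.2 ((hA.sub hB).hasSum b)
  have h₃ := Complex.hasSum_ofReal.2 ((hA.sub (hB.smul Complex.I)).hasSum b)
  have h₄ := Complex.hasSum_ofReal.2 ((hA.add (hB.smul Complex.I)).hasSum b)
  convert! ((h₁.sub h₂).add ((h₃.sub h₄).mul_right Complex.I)).div_const 4 using 1
  funext i
  rw [inner_eq_sum_norm_sq_div_four]
  simp

/-- The four polarization terms match one by one: the operators are adjoints of each other up to a
factor of modulus one. -/
theorem IsHilbertSchmidt.hsInner_adjoint {A B : H →L[ℂ] H} (hA : IsHilbertSchmidt A)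
    (hB : IsHilbertSchmidt B) : hsInner (star B) (star A) = hsInner A B := by
  have h₁ := (hA.add hB).hsNormSq_adjoint
  have h₂ := (hA.sub hB).hsNormSq_adjoint
  have h₃ := (hA.sub (hB.smul Complex.I)).hsNormSq_adjoint
  have h₄ := (hA.add (hB.smul Complex.I)).hsNormSq_adjoint
  have e₂ : hsNormSq (star B - star A) = hsNormSq (star (A - B)) := by
    rw [star_sub]; simp only [hsNormSq, sub_apply, norm_sub_rev]
  have e₃ : hsNormSq (star B - Complex.I • star A) = hsNormSq (star (A - Complex.I • B)) := by
    have : star (A - Complex.I • B) = Complex.I • (star B - Complex.I • star A) := by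
      rw [star_sub, star_smul, smul_sub, smul_smul]; simp [add_comm]
    rw [this, hsNormSq, hsNormSq]; simp only [smul_apply, norm_smul]; simp
  have e₄ : hsNormSq (star B + Complex.I • star A) = hsNormSq (star (A + Complex.I • B)) := by
    have : star (A + Complex.I • B) = -Complex.I • (star B + Complex.I • star A) := by
      rw [star_add, star_smul, smul_add, smul_smul]; simp [add_comm]
    rw [this, hsNormSq, hsNormSq]; simp only [smul_apply, norm_smul]; simp
  rw [hsInner, hsInner, e₂, e₃, e₄, add_comm (star B), ← star_add, h₁, h₂, h₃, h₄]

/-! ### Traces -/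

namespace HasTrace

variable {S T : H →L[ℂ] H} {s t : ℂ}

theorem trace_eq (h : HasTrace T t) : trace T = t := (h _ (onb H)).tsum_eq

omit [CompleteSpace H] in
theorem add (hS : HasTrace S s) (hT : HasTrace T t) : HasTrace (S + T) (s + t) := fun ι b => by
  simpa [inner_add_right] using (hS ι b).add (hT ι b)

omit [CompleteSpace H] in
theorem sub (hS : HasTrace S s) (hT : HasTrace T t) : HasTrace (S - T) (s - t) := fun ι b => by
  simpa [inner_sub_right] using (hS ι b).sub (hT ι b)

theorem validity_eq {ρ p : H →L[ℂ] H} {r : ℝ} (h : HasTrace (ρ * p) r) : validity ρ p = r := by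
  rw [validity, h.trace_eq, Complex.ofReal_re]

end HasTrace

theorem inner_eq_norm_sqrt_sq {ρ : H →L[ℂ] H} (hρ : 0 ≤ ρ) (x : H) :
    ⟪x, ρ x⟫_ℂ = (‖CFC.sqrt ρ x‖ ^ 2 : ℝ) := by
  have hS : (CFC.sqrt ρ).IsPositive :=
    (ContinuousLinearMap.nonneg_iff_isPositive _).1 (CFC.sqrt_nonneg ρ)
  conv_lhs => rw [← CFC.sqrt_mul_sqrt_self ρ hρ]
  rw [show (CFC.sqrt ρ * CFC.sqrt ρ) x = CFC.sqrt ρ (CFC.sqrt ρ x) from rfl,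
    ← hS.inner_left_eq_inner_right, inner_self_eq_norm_sq_to_K]
  push_cast
  rfl

theorem isHilbertSchmidt_sqrt {ρ : H →L[ℂ] H} (hρ : 0 ≤ ρ)
    (h : Summable fun i => ⟪onb H i, ρ (onb H i)⟫_ℂ) : IsHilbertSchmidt (CFC.sqrt ρ) := by
  simp_rw [inner_eq_norm_sqrt_sq hρ] at h
  exact Complex.summable_ofReal.1 h

/-- A divergent series would give `trace` its default value 0, not 1. -/
theorem IsState.isHilbertSchmidt_sqrt {ρ : H →L[ℂ] H} (h : IsState ρ) :
    IsHilbertSchmidt (CFC.sqrt ρ) := by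
  refine QuantumTrace.isHilbertSchmidt_sqrt h.1 (by_contra fun hn => ?_)
  have := h.2
  rw [trace, tsum_eq_zero_of_not_summable hn] at this
  exact zero_ne_one this

section Sqrt

variable {ρ : H →L[ℂ] H}

theorem hasTrace_mul (hρ : 0 ≤ ρ) (hS : IsHilbertSchmidt (CFC.sqrt ρ)) (X : H →L[ℂ] H) :
    HasTrace (ρ * X) (hsInner (CFC.sqrt ρ) (CFC.sqrt ρ * X)) := fun ι b => by
  have hP : (CFC.sqrt ρ).IsPositive :=
    (ContinuousLinearMap.nonneg_iff_isPositive _).1 (CFC.sqrt_nonneg ρ)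
  convert hS.hasSum_inner (hS.mul_right X) b using 1
  funext i
  conv_lhs => rw [← CFC.sqrt_mul_sqrt_self ρ hρ]
  exact hP.inner_left_eq_inner_right _ _ |>.symm

/-- Cyclicity of the trace: the value is that of `hasTrace_mul`, but in this form positivity for
positive X is visible term by term. -/
theorem hasTrace_sqrt_conj (hS : IsHilbertSchmidt (CFC.sqrt ρ)) (X : H →L[ℂ] H) :
    HasTrace (CFC.sqrt ρ * X * CFC.sqrt ρ) (hsInner (CFC.sqrt ρ) (CFC.sqrt ρ * X)) := fun ι b => by
  have hP : (CFC.sqrt ρ).IsPositive :=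
    (ContinuousLinearMap.nonneg_iff_isPositive _).1 (CFC.sqrt_nonneg ρ)
  have h := (hS.mul_right X).adjoint.hasSum_inner hS.adjoint b
  rw [hS.hsInner_adjoint (hS.mul_right X)] at h
  convert h using 1
  funext i
  rw [ContinuousLinearMap.star_eq_adjoint, ContinuousLinearMap.adjoint_inner_left,
    hP.isSelfAdjoint.star_eq]
  rfl

theorem exists_hasTrace (hρ : 0 ≤ ρ) (hS : IsHilbertSchmidt (CFC.sqrt ρ)) :
    ∃ r : ℝ, HasTrace ρ r := by
  refine ⟨hsNormSq (CFC.sqrt ρ), fun ι b => ?_⟩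
  simp_rw [inner_eq_norm_sqrt_sq hρ]
  exact Complex.hasSum_ofReal.2 (hS.hasSum b)

theorem exists_hasTrace_mul_effect (hρ : 0 ≤ ρ) (hS : IsHilbertSchmidt (CFC.sqrt ρ))
    {p : H →L[ℂ] H} (hp : IsEffect p) {r : ℝ}
    (hr : HasTrace ρ r) : ∃ t : ℝ, HasTrace (ρ * p) t ∧ 0 ≤ t ∧ t ≤ r := by
  have hP : (CFC.sqrt ρ).IsPositive :=
    (ContinuousLinearMap.nonneg_iff_isPositive _).1 (CFC.sqrt_nonneg ρ)
  have h₀ := (ContinuousLinearMap.nonneg_iff_isPositive p).1 hp.1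
  have h₁ := (ContinuousLinearMap.le_def p 1).1 hp.2
  have key : ∀ X : H →L[ℂ] H, X.IsPositive →
      ∃ t : ℝ, (t : ℂ) = hsInner (CFC.sqrt ρ) (CFC.sqrt ρ * X) ∧ 0 ≤ t := by
    intro X hX
    have h := hasTrace_sqrt_conj hS X _ (onb H)
    have h' : 0 ≤ hsInner (CFC.sqrt ρ) (CFC.sqrt ρ * X) := h.nonneg fun i => by
      exact (hX.inner_nonneg_right _).trans_eq (hP.inner_left_eq_inner_right _ _)
    obtain ⟨hre, him⟩ := Complex.le_def.1 h'
    exact ⟨_, Complex.ext rfl him, hre⟩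
  -- The upper bound is positivity for `1 - p`: the two traces add up to `r`.
  obtain ⟨t, ht, ht₀⟩ := key p h₀
  obtain ⟨u, hu, hu₀⟩ := key (1 - p) h₁
  have hp' := ht ▸ hasTrace_mul hρ hS p
  have hq' := hu ▸ hasTrace_mul hρ hS (1 - p)
  have hsum := hp'.add hq'
  rw [← mul_add, add_sub_cancel, mul_one] at hsum
  have : (r : ℂ) = t + u := hr.trace_eq.symm.trans hsum.trace_eq
  norm_cast at this
  exact ⟨t, hp', ht₀, by linarith⟩

end Sqrt

/-! ### The support projection of the positive part -/

theorem _root_.IsStarProjection.isSharpEffect {s : H →L[ℂ] H} (h : IsStarProjection s) :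
    IsSharpEffect s :=
  ⟨⟨h.nonneg, h.le_one⟩, by rw [pow_two]; exact h.isIdempotentElem⟩

/-- The projection is onto the orthogonal complement of ker A, and A B = 0 puts the range of B
inside ker A. -/
theorem exists_isStarProjection_mul_eq_left {A B : H →L[ℂ] H} (hB : IsSelfAdjoint B)
    (hAB : A * B = 0) :
    ∃ s : H →L[ℂ] H, IsStarProjection s ∧ A * s = A ∧ B * s = 0 := by
  have hc : IsClosed (A.ker : Set H) := A.isClosed_ker
  have : CompleteSpace A.ker := hc.completeSpace_coe
  set P := A.ker.starProjection with hPdef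
  have hP : IsStarProjection P := isStarProjection_starProjection
  have hA : A * P = 0 := by
    ext x
    exact A.ker.starProjection_apply_mem x
  have hPB : P * B = B := by
    ext x
    exact Submodule.starProjection_eq_self_iff.2 (by simpa using congr($hAB x))
  have hBP : B * P = B := by
    have := congr(star $hPB)
    rwa [star_mul, hB.star_eq, hP.isSelfAdjoint.star_eq] at this
  exact ⟨1 - P, hP.one_sub, by rw [mul_sub, hA, mul_one, sub_zero],
    by rw [mul_sub, hBP, mul_one, sub_self]⟩

end QuantumTrace

open QuantumTrace in
theorem proposition2p5 {H : Type*} [NormedAddCommGroup H] [InnerProductSpace ℂ H]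
    [CompleteSpace H] (ρ₁ ρ₂ : H →L[ℂ] H)
    (h₁ : QuantumTrace.IsState ρ₁) (h₂ : QuantumTrace.IsState ρ₂) :
    -- the traces that occur are well-defined real numbers, independent of the orthonormal basis
    (∀ p : H →L[ℂ] H, QuantumTrace.IsEffect p →
      QuantumTrace.HasTrace (ρ₁ * p) (QuantumTrace.validity ρ₁ p : ℂ) ∧
      QuantumTrace.HasTrace (ρ₂ * p) (QuantumTrace.validity ρ₂ p : ℂ)) ∧
    QuantumTrace.HasTrace (CFC.abs (ρ₁ - ρ₂)) ((2 * QuantumTrace.trd ρ₁ ρ₂ : ℝ) : ℂ) ∧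
    -- the trace distance is the supremum over all effects
    IsLUB {x : ℝ | ∃ p : H →L[ℂ] H, QuantumTrace.IsEffect p ∧
        x = |QuantumTrace.validity ρ₁ p - QuantumTrace.validity ρ₂ p|}
      (QuantumTrace.trd ρ₁ ρ₂) ∧
    -- and the maximum, without absolute value, over the sharp effects
    IsGreatest {x : ℝ | ∃ s : H →L[ℂ] H, QuantumTrace.IsSharpEffect s ∧
        x = QuantumTrace.validity ρ₁ s - QuantumTrace.validity ρ₂ s}
      (QuantumTrace.trd ρ₁ ρ₂) := by
  obtain ⟨hp₁, hS₁⟩ : 0 ≤ ρ₁ ∧ IsHilbertSchmidt (CFC.sqrt ρ₁) := ⟨h₁.1, h₁.isHilbertSchmidt_sqrt⟩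
  obtain ⟨hp₂, hS₂⟩ : 0 ≤ ρ₂ ∧ IsHilbertSchmidt (CFC.sqrt ρ₂) := ⟨h₂.1, h₂.isHilbertSchmidt_sqrt⟩
  have ht₁ : HasTrace ρ₁ (1 : ℝ) := by
    obtain ⟨r, hr⟩ := exists_hasTrace hp₁ hS₁
    have := hr.trace_eq.symm.trans h₁.2
    rwa [this] at hr
  have ht₂ : HasTrace ρ₂ (1 : ℝ) := by
    obtain ⟨r, hr⟩ := exists_hasTrace hp₂ hS₂
    have := hr.trace_eq.symm.trans h₂.2
    rwa [this] at hr
  have hv : ∀ p : H →L[ℂ] H, IsEffect p →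
      HasTrace (ρ₁ * p) (validity ρ₁ p : ℂ) ∧ HasTrace (ρ₂ * p) (validity ρ₂ p : ℂ) := by
    intro p hp
    obtain ⟨t, ht, -⟩ := exists_hasTrace_mul_effect hp₁ hS₁ hp ht₁
    obtain ⟨u, hu, -⟩ := exists_hasTrace_mul_effect hp₂ hS₂ hp ht₂
    exact ⟨by rwa [ht.validity_eq], by rwa [hu.validity_eq]⟩
  have hD : IsSelfAdjoint (ρ₁ - ρ₂) := hp₁.isSelfAdjoint.sub hp₂.isSelfAdjoint
  have htD : HasTrace (ρ₁ - ρ₂) 0 := by simpa using ht₁.sub ht₂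
  have hvD : ∀ p : H →L[ℂ] H, IsEffect p →
      HasTrace ((ρ₁ - ρ₂) * p) ((validity ρ₁ p - validity ρ₂ p : ℝ) : ℂ) := by
    intro p hp
    rw [sub_mul, Complex.ofReal_sub]
    exact (hv p hp).1.sub (hv p hp).2
  set D := ρ₁ - ρ₂ with hDdef
  have hsub : D⁺ - D⁻ = D := CFC.posPart_sub_negPart D hD
  obtain ⟨s, hs, hs₁, hs₂⟩ := exists_isStarProjection_mul_eq_left
    (A := D⁺) (B := D⁻) (CFC.negPart_nonneg D).isSelfAdjoint (CFC.posPart_mul_negPart D)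
  have hsE := hs.isSharpEffect
  set d := validity ρ₁ s - validity ρ₂ s with hd
  -- D⁺ = D s, so D⁺ inherits a finite trace from ρ₁ s and ρ₂ s.
  have htP : HasTrace D⁺ (d : ℂ) := by
    have h := hvD s hsE.1
    rwa [← hsub, sub_mul, hs₁, hs₂, sub_zero] at h
  have htN : HasTrace D⁻ (d : ℂ) := by
    have h := htP.sub htD
    rwa [sub_zero, show D⁺ - D = D⁻ by nth_rw 2 [← hsub]; abel] at h
  have habs : HasTrace (CFC.abs D) ((2 * d : ℝ) : ℂ) := by
    have h := htP.add htN
    rwa [CFC.posPart_add_negPart D hD, ← two_mul, ← Complex.ofReal_ofNat,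
      ← Complex.ofReal_mul] at h
  have htrd : trd ρ₁ ρ₂ = d := by
    rw [trd, ← hDdef, habs.trace_eq, Complex.ofReal_re]
    ring
  have hbound : ∀ p : H →L[ℂ] H, IsEffect p → |validity ρ₁ p - validity ρ₂ p| ≤ d := by
    intro p hp
    obtain ⟨t, ht, ht₀, htd⟩ := exists_hasTrace_mul_effect (CFC.posPart_nonneg D)
      (isHilbertSchmidt_sqrt (CFC.posPart_nonneg D) (htP _ (onb H)).summable) hp htP
    obtain ⟨u, hu, hu₀, hud⟩ := exists_hasTrace_mul_effect (CFC.negPart_nonneg D)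
      (isHilbertSchmidt_sqrt (CFC.negPart_nonneg D) (htN _ (onb H)).summable) hp htN
    have h := ht.sub hu
    rw [← sub_mul, hsub] at h
    have h' := (hvD p hp).trace_eq.symm.trans h.trace_eq
    norm_cast at h'
    rw [h', abs_le]
    constructor <;> linarith
  have hd₀ : 0 ≤ d := (abs_nonneg _).trans (hbound s hsE.1)
  rw [htrd]
  refine ⟨hv, habs, ⟨?_, fun x hx => hx ⟨s, hsE.1, (abs_of_nonneg hd₀).symm⟩⟩, ⟨s, hsE, rfl⟩, ?_⟩
  · rintro x ⟨p, hp, rfl⟩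
    exact hbound p hp
  · rintro x ⟨p, hp, rfl⟩
    exact (le_abs_self _).trans (hbound p hp.1)
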